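/- **Setting.** Let $p$ be fixed, $\mathcal X\subseteq\mathbb R^p$, and let $Z_1,Z_2,\dots$ be i.i.d. complete observations $Z=(Y,X)\in\mathbb R\times\mathcal X$ from $P_0\in\mathcal M$, a set of probability distributions. Let $\mathcal F$ be a class of functions $\mathcal X\to\mathbb R$; for $s\subseteq\{1,\dots,p\}$ let $\mathcal F_s=\{f\in\mathcal F: f(u)=f(v)\text{ whenever }u_s=v_s\}$, with a (semi)norm $\|\cdot\|_{\mathcal F_s}$ defined on a linear space of functions containing $\mathcal F$. Let $V(f,P)\in\mathbb R$ be a predictiveness measure, defined for $P$ a finite signed measure, and $f_{0,s}\in\arg\max_{f\in\mathcal F_s}V(f,P_0)$ (assumed to exist). Put $$\psi_{0,j}=\sum_{s\subseteq\{1,\dots,p\}\setminus\{j\}}\binom{p-1}{|s|}^{-1}\frac1p\{V(f_{0,s\cup\{j\}},P_0)-V(f_{0,s},P_0)\},\qquad S_0=\{j:\psi_{0,j}>0\}.$$ Let $f_{n,s}\in\mathcal F_s$ be an estimator of $f_{0,s}$: a (possibly randomized) learner applied to $Z_1,\dots,Z_n$. Let $\mathcal R=\{a(P_1-P_2):a\in\mathbb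 R,\ P_1,P_2\in\mathcal M\}$, let $\|R\|_\infty$ be the supremum norm of the distribution function of a signed measure $R$, let $\dot V(f,P_0;h)$ be the Gâteaux derivative of $P\mapsto V(f,P)$ at $P_0$ in direction $h$, and $g_{n,s}(z)=\dot V(f_{n,s},P_0;\delta_z-P_0)-\dot V(f_{0,s},P_0;\delta_z-P_0)$. **Selection algorithm (complete data).** (1) Draw $c=c(n)$ subsets $s_1,\dots,s_c$ of $\{1,\dots,p\}$ i.i.d., independently of the data, with probability proportional to $\binom{p-2}{|s|-1}^{-1}$ (to $1$ for $s=\emptyset$ and $s=\{1,\dots,p\}$). With $v_{n,s}$ the $K$-fold ($K\ge2$) cross-fitted estimate of $V(f_{0,s},P_0)$ (for each fold, the learner fitted on the other folds is evaluated by $V$ at the empirical distribution of the fold; then average over the folds), let $\psi_n$ minimize $\sum_{i\le c}\big(v_{n,s_i}-v_{n,\emptyset}-\sum_{j\in s_i}\psi_j\big)^2$ subject to $\sum_{j}\psi_j=v_{n,\{1,\dots,p\}}-v_{n,\emptyset}$. (2) With standard errors $\omega_{n,j}$ from any variance estimator, form $T_{n,j}=\psi_{n,j}/\omega_{n,j}$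 and the p-values $1-\Phi(T_{n,j})$. (3) Compute adjusted p-values $\tilde p_{n,j}$ by any (possibly random) multiple-testing procedure. (4) For $\alpha\in(0,1)$ let $S_n(\alpha)=\{j:\tilde p_{n,j}<\alpha\}$. (5) For some (possibly data-dependent) $k\in\{0,\dots,p-|S_n(\alpha)|\}$ let $A_n(k,\alpha)=\emptyset$ if $k=0$; otherwise let $A_n(k,\alpha)$ be the set of $\ell\notin S_n(\alpha)$ for which $\tilde p_{n,\ell}$ is at most the $k$-th smallest of the adjusted p-values of the unselected variables. (6) Let $S_n^+(k,\alpha)=S_n(\alpha)\cup A_n(k,\alpha)$. **Conditions.** For every $s\subseteq\{1,\dots,p\}$: - (A1) There is $C>0$ such that for every sequence $f_1,f_2,\dots\in\mathcal F_s$ with $\|f_j-f_{0,s}\|_{\mathcal F_s}\to0$ one has $|V(f_j,P_0)-V(f_{0,s},P_0)|\le C\|f_j-f_{0,s}\|_{\mathcal F_s}^2$ for all large $j$. - (A2) There is $\delta>0$ such that for all real $\epsilon_j\ne0$, $\epsilon_j\to0$, and $h,h_1,h_2,\dots\in\mathcal R$ with $\|h_j-h\|_\infty\to0$, $$\sup_{f\in\mathcal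 F_s:\|f-f_{0,s}\|_{\mathcal F_s}<\delta}\Big|\frac{V(f,P_0+\epsilon_jh_j)-V(f,P_0)}{\epsilon_j}-\dot V(f,P_0;h_j)\Big|\to0.$$ - (A5) $\|f_{n,s}-f_{0,s}\|_{\mathcal F_s}=o_P(n^{-1/4})$. - (A6) The derivatives in $g_{n,s}$ exist almost everywhere and $E[\int g_{n,s}(z)^2\,dP_0(z)]\to0$. Moreover: - (A7) $c(n)=\gamma_nn$ with $\gamma_n>0$ and $\gamma_n\to\gamma>0$. - (B3) $\lim_{n\to\infty}\Pr(S_0\subseteq S_n(\alpha))=1$. **Claim.** Under (A1), (A2), (A5), (A6) for all $s$, together with (A7) and (B3), the algorithm is persistent: $$V\big(f_{n,S_n^+(k,\alpha)},P_0\big)-V(f_*,P_0)\to0\quad\text{in probability},$$ where $f_*=f_{*,n}$ is any maximizer of $V(\cdot,P_0)$ over $\bigcup_{|s|=k_n}\mathcal F_s$ with $k_n=|S_n^+(k,\alpha)|$, that is, over all functions of the class that use the same number of variables as were selected. -/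

import Mathlib

open MeasureTheory ProbabilityTheory Filter Topology
open scoped ENNReal

namespace IntrinsicSelection

noncomputable section

/-- A complete-data unit `(Y, X)` with outcome `Y ∈ ℝ` and covariates `X ∈ 𝒳 ⊆ ℝ^p`. -/
abbrev Obs {p : ℕ} (𝒳 : Set (Fin p → ℝ)) : Type := ℝ × 𝒳

/-! ### Function classes, oracle predictors, Shapley importance -/

/-- `𝓕_s`: the functions of the class `F` that use only the coordinates in `s`. -/
def restrictedClass {p : ℕ} {𝒳 : Set (Fin p → ℝ)} {E : Submodule ℝ (𝒳 → ℝ)}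
    (F : Set E) (s : Finset (Fin p)) : Set E :=
  {f | f ∈ F ∧ ∀ u v : 𝒳, (∀ j ∈ s, (u : Fin p → ℝ) j = (v : Fin p → ℝ) j) →
    (f : 𝒳 → ℝ) u = (f : 𝒳 → ℝ) v}

/-- `⋃_{|s| = k} 𝓕_s`: the functions of the class `F` that use `k` variables. -/
def sizeClass {p : ℕ} {𝒳 : Set (Fin p → ℝ)} {E : Submodule ℝ (𝒳 → ℝ)}
    (F : Set E) (k : ℕ) : Set E :=
  {f | ∃ s : Finset (Fin p), s.card = k ∧ f ∈ restrictedClass F s}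

/-- The signed measure underlying a probability distribution. -/
def toSigned {p : ℕ} {𝒳 : Set (Fin p → ℝ)} (P : ProbabilityMeasure (Obs 𝒳)) :
    SignedMeasure (Obs 𝒳) :=
  (P : Measure (Obs 𝒳)).toSignedMeasure

/-- `f ∈ argmax_{g ∈ A} V(g, P)`. -/
def IsPredictivenessMaximizer {p : ℕ} {𝒳 : Set (Fin p → ℝ)} {E : Submodule ℝ (𝒳 → ℝ)}
    (V : E → SignedMeasure (Obs 𝒳) → ℝ) (P : ProbabilityMeasure (Obs 𝒳))
    (A : Set E) (f : E) : Prop :=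
  f ∈ A ∧ ∀ g ∈ A, V g (toSigned P) ≤ V f (toSigned P)

/-- The Shapley population variable importance of feature `j`, given the oracle predictiveness
`v s = V(f_{0,s}, P_0)` of each feature set `s`. -/
def spvim {p : ℕ} (v : Finset (Fin p) → ℝ) (j : Fin p) : ℝ :=
  ∑ s ∈ (Finset.univ.erase j).powerset,
    ((Nat.choose (p - 1) s.card : ℝ))⁻¹ * (1 / (p : ℝ)) * (v (insert j s) - v s)

/-- The active set `S_0 = {j : ψ_{0,j} > 0}`. -/
def activeSet {p : ℕ} (v : Finset (Fin p) → ℝ) : Finset (Fin p) :=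
  {j | 0 < spvim v j}

/-! ### Perturbations of the distribution and Gâteaux derivatives -/

/-- `𝓡 = {c (P₁ - P₂) : c ∈ ℝ, P₁, P₂ ∈ 𝓜}`. -/
def directions {p : ℕ} {𝒳 : Set (Fin p → ℝ)} (M : Set (ProbabilityMeasure (Obs 𝒳))) :
    Set (SignedMeasure (Obs 𝒳)) :=
  {R | ∃ c : ℝ, ∃ P₁ ∈ M, ∃ P₂ ∈ M, R = c • (toSigned P₁ - toSigned P₂)}

/-- The supremum norm of the distribution function of a signed measure on `ℝ × 𝒳 ⊆ ℝ × ℝ^p`. -/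
def supNorm {p : ℕ} {𝒳 : Set (Fin p → ℝ)} (R : SignedMeasure (Obs 𝒳)) : ℝ≥0∞ :=
  ⨆ z : ℝ × (Fin p → ℝ),
    ENNReal.ofReal |R {o : Obs 𝒳 | o.1 ≤ z.1 ∧ (o.2 : Fin p → ℝ) ≤ z.2}|

/-- `P ↦ V(f, P)` has a Gâteaux derivative at `P` in the direction `h`. -/
def GateauxDifferentiable {p : ℕ} {𝒳 : Set (Fin p → ℝ)} {E : Submodule ℝ (𝒳 → ℝ)}
    (V : E → SignedMeasure (Obs 𝒳) → ℝ) (f : E) (P h : SignedMeasure (Obs 𝒳)) : Prop :=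
  DifferentiableAt ℝ (fun ε : ℝ => V f (P + ε • h)) 0

/-- The Gâteaux derivative of `P ↦ V(f, P)` at `P` in the direction `h`. -/
def gateaux {p : ℕ} {𝒳 : Set (Fin p → ℝ)} {E : Submodule ℝ (𝒳 → ℝ)}
    (V : E → SignedMeasure (Obs 𝒳) → ℝ) (f : E) (P h : SignedMeasure (Obs 𝒳)) : ℝ :=
  deriv (fun ε : ℝ => V f (P + ε • h)) 0

/-- The direction `δ_z - P`. -/
def pointDirection {p : ℕ} {𝒳 : Set (Fin p → ℝ)} (P : ProbabilityMeasure (Obs 𝒳))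
    (z : Obs 𝒳) : SignedMeasure (Obs 𝒳) :=
  (Measure.dirac z).toSignedMeasure - toSigned P

/-! ### Regularity conditions -/

/-- Optimality of `f₀` in `A`: the loss of predictiveness is locally quadratic. -/
def Optimality {p : ℕ} {𝒳 : Set (Fin p → ℝ)} {E : Submodule ℝ (𝒳 → ℝ)}
    (V : E → SignedMeasure (Obs 𝒳) → ℝ) (P : ProbabilityMeasure (Obs 𝒳))
    (A : Set E) (nrm : Seminorm ℝ E) (f₀ : E) : Prop :=
  ∃ C > 0, ∀ f : ℕ → E, (∀ j, f j ∈ A) →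
    Tendsto (fun j => nrm (f j - f₀)) atTop (𝓝 0) →
    ∃ J, ∀ j > J, |V (f j) (toSigned P) - V f₀ (toSigned P)| ≤ C * nrm (f j - f₀) ^ 2

/-- Differentiability of `P ↦ V(f, P)`, uniformly in `f` near `f₀` and along converging
directions. The supremum is taken in `[0, ∞]`. -/
def UniformDifferentiability {p : ℕ} {𝒳 : Set (Fin p → ℝ)} {E : Submodule ℝ (𝒳 → ℝ)}
    (V : E → SignedMeasure (Obs 𝒳) → ℝ) (M : Set (ProbabilityMeasure (Obs 𝒳)))
    (P : ProbabilityMeasure (Obs 𝒳)) (A : Set E) (nrm : Seminorm ℝ E) (f₀ : E) : Prop :=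
  ∃ δ > 0, ∀ (ε : ℕ → ℝ) (h : SignedMeasure (Obs 𝒳)) (hs : ℕ → SignedMeasure (Obs 𝒳)),
    (∀ j, ε j ≠ 0) → h ∈ directions M → (∀ j, hs j ∈ directions M) →
    Tendsto ε atTop (𝓝 0) → Tendsto (fun j => supNorm (hs j - h)) atTop (𝓝 0) →
    Tendsto (fun j => ⨆ f ∈ {f | f ∈ A ∧ nrm (f - f₀) < δ},
      ENNReal.ofReal |(V f (toSigned P + ε j • hs j) - V f (toSigned P)) / ε j
        - gateaux V f (toSigned P) (hs j)|) atTop (𝓝 0)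

/-- `‖f_n - f₀‖ = o_P(n^{-1/4})` for a sequence of random functions `f_n`. -/
def QuarterRate {p : ℕ} {𝒳 : Set (Fin p → ℝ)} {E : Submodule ℝ (𝒳 → ℝ)}
    {Ω : Type*} [MeasurableSpace Ω] (μ : Measure Ω) (nrm : Seminorm ℝ E)
    (f : ℕ → Ω → E) (f₀ : E) : Prop :=
  TendstoInMeasure μ (fun (n : ℕ) ω => (n : ℝ) ^ (1 / 4 : ℝ) * nrm (f n ω - f₀)) atTop (fun _ => 0)

/-- `E[∫ g_n² dP] → 0` where `g_n(z) = V̇(f_n, P; δ_z - P) - V̇(f₀, P; δ_z - P)`; the derivatives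
that enter `g_n` exist. -/
def DerivativeConsistency {p : ℕ} {𝒳 : Set (Fin p → ℝ)} {E : Submodule ℝ (𝒳 → ℝ)}
    {Ω : Type*} [MeasurableSpace Ω] (μ : Measure Ω)
    (V : E → SignedMeasure (Obs 𝒳) → ℝ) (P : ProbabilityMeasure (Obs 𝒳))
    (f : ℕ → Ω → E) (f₀ : E) : Prop :=
  (∀ᵐ z ∂(P : Measure (Obs 𝒳)),
    GateauxDifferentiable V f₀ (toSigned P) (pointDirection P z)) ∧
  (∀ n, ∀ᵐ ω ∂μ, ∀ᵐ z ∂(P : Measure (Obs 𝒳)),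
    GateauxDifferentiable V (f n ω) (toSigned P) (pointDirection P z)) ∧
  Tendsto (fun n => ∫⁻ ω, ∫⁻ z, ENNReal.ofReal
      ((gateaux V (f n ω) (toSigned P) (pointDirection P z)
        - gateaux V f₀ (toSigned P) (pointDirection P z)) ^ 2)
      ∂(P : Measure (Obs 𝒳)) ∂μ) atTop (𝓝 0)

/-- The number of sampled feature sets is `c = γ_n n` with `γ_n → γ > 0`. -/
def SubsetCountRate (c : ℕ → ℕ) : Prop :=
  ∃ γ > 0, ∃ γs : ℕ → ℝ, (∀ n, 0 < γs n) ∧ Tendsto γs atTop (𝓝 γ) ∧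
    ∀ n, (c n : ℝ) = γs n * n

/-! ### The sampling of the data and of the feature sets -/

/-- `Z_0, Z_1, …` are independent draws from `P`. -/
def IsIIDSample {p : ℕ} {𝒳 : Set (Fin p → ℝ)} {Ω : Type*} [MeasurableSpace Ω]
    (μ : Measure Ω) (P : ProbabilityMeasure (Obs 𝒳)) (Z : ℕ → Ω → Obs 𝒳) : Prop :=
  (∀ i, Measurable (Z i)) ∧ iIndepFun Z μ ∧ ∀ i, μ.map (Z i) = (P : Measure (Obs 𝒳))

/-- The observations whose index is below `n` and satisfies `q`. -/
def subsample {p : ℕ} {𝒳 : Set (Fin p → ℝ)} (z : ℕ → Obs 𝒳) (n : ℕ) (q : ℕ → Bool) :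
    List (Obs 𝒳) :=
  ((List.range n).filter q).map z

/-- The estimator `f_{n,s}`: the learner for `s` applied to the first `n` observations. -/
def fullFit {p : ℕ} {𝒳 : Set (Fin p → ℝ)} {E : Submodule ℝ (𝒳 → ℝ)} {Ω : Type*}
    (learner : Ω → Finset (Fin p) → List (Obs 𝒳) → E) (Z : ℕ → Ω → Obs 𝒳)
    (s : Finset (Fin p)) (n : ℕ) (ω : Ω) : E :=
  learner ω s (subsample (fun i => Z i ω) n (fun _ => true))

/-- The Shapley kernel weight of a feature set. -/
def shapleyWeight {p : ℕ} (s : Finset (Fin p)) : ℝ :=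
  if s = ∅ ∨ s = Finset.univ then 1 else ((Nat.choose (p - 2) (s.card - 1) : ℝ))⁻¹

/-- For each sample size `n`, the `c n` sampled feature sets are independent of each other and of
the data, each drawn with probability proportional to the Shapley kernel weight. -/
def IsSubsetSample {p : ℕ} {𝒳 : Set (Fin p → ℝ)} {Ω : Type*} [MeasurableSpace Ω]
    (μ : Measure Ω) (Z : ℕ → Ω → Obs 𝒳) (c : ℕ → ℕ)
    (draw : (n : ℕ) → Fin (c n) → Ω → Finset (Fin p)) : Prop :=
  (∀ n i, Measurable (draw n i)) ∧ (∀ n, iIndepFun (draw n) μ) ∧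
  (∀ n i s, μ {ω | draw n i ω = s} =
    ENNReal.ofReal (shapleyWeight s / ∑ t : Finset (Fin p), shapleyWeight t)) ∧
  (∀ n, IndepFun (fun ω i => draw n i ω) (fun ω (i : Fin n) => Z i ω) μ)

/-! ### Estimation of the Shapley importance -/

/-- The empirical distribution of a list of observations. -/
def empirical {p : ℕ} {𝒳 : Set (Fin p → ℝ)} (l : List (Obs 𝒳)) : SignedMeasure (Obs 𝒳) :=
  (l.length : ℝ)⁻¹ • (l.map (fun z => (Measure.dirac z).toSignedMeasure)).sum

/-- The `K`-fold cross-fitted predictiveness: the function fitted outside fold `k` is evaluated at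
the empirical distribution of fold `k`, and the results are averaged over `k`. -/
def crossFitted {p : ℕ} {𝒳 : Set (Fin p → ℝ)} {E : Submodule ℝ (𝒳 → ℝ)} {K : ℕ}
    (V : E → SignedMeasure (Obs 𝒳) → ℝ) (fit : List (Obs 𝒳) → E)
    (fold : ℕ → Fin K) (n : ℕ) (z : ℕ → Obs 𝒳) : ℝ :=
  (K : ℝ)⁻¹ * ∑ k : Fin K, V (fit (subsample z n (fun i => fold i ≠ k)))
    (empirical (subsample z n (fun i => fold i = k)))

/-- The estimator of the Shapley importance from the sampled feature sets `draw` and the estimated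
predictiveness `v`: `ψ` minimizes the residual sum of squares `∑ᵢ (v(sᵢ) - v(∅) - ∑_{j ∈ sᵢ} ψ_j)²`
under the constraint `∑_j ψ_j = v({1,…,p}) - v(∅)`. -/
def IsSpvimEstimate {p c : ℕ} (v : Finset (Fin p) → ℝ) (draw : Fin c → Finset (Fin p))
    (ψ : Fin p → ℝ) : Prop :=
  (∑ j, ψ j = v Finset.univ - v ∅) ∧
  ∀ φ : Fin p → ℝ, ∑ j, φ j = v Finset.univ - v ∅ →
    ∑ i, (v (draw i) - v ∅ - ∑ j ∈ draw i, ψ j) ^ 2 ≤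
      ∑ i, (v (draw i) - v ∅ - ∑ j ∈ draw i, φ j) ^ 2

/-! ### Selection and augmentation -/

/-- The test statistics for `ψ_{0,j} = 0`. -/
def testStatistic {p : ℕ} (ψ se : Fin p → ℝ) (j : Fin p) : ℝ := (se j)⁻¹ * ψ j

/-- One-sided unadjusted p-values under the standard normal limit. -/
def pValue {p : ℕ} (T : Fin p → ℝ) (j : Fin p) : ℝ := 1 - cdf (gaussianReal 0 1) (T j)

/-- The initial set `S(α)`: the features whose adjusted p-value is below `α`. -/
def initialSet {p : ℕ} (a : Fin p → ℝ) (α : ℝ) : Finset (Fin p) := {j | a j < α}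

/-- The `k`-th smallest of the numbers `a j`, `j ∈ s`, for `1 ≤ k ≤ |s|`. -/
def orderStatistic {p : ℕ} (s : Finset (Fin p)) (a : Fin p → ℝ) (k : ℕ) : ℝ :=
  ((s.val.map a).sort (· ≤ ·)).getD (k - 1) 0

/-- The augmentation set `A(k, α)`: the unselected features whose adjusted p-value is at most the
`k`-th smallest adjusted p-value of the unselected features. -/
def augmentation {p : ℕ} (a : Fin p → ℝ) (α : ℝ) (k : ℕ) : Finset (Fin p) :=
  if k = 0 then ∅
  else {l ∈ (initialSet a α)ᶜ | a l ≤ orderStatistic (initialSet a α)ᶜ a k}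

/-- The augmented set `S⁺(k, α) = S(α) ∪ A(k, α)`. -/
def augmentedSet {p : ℕ} (a : Fin p → ℝ) (α : ℝ) (k : ℕ) : Finset (Fin p) :=
  initialSet a α ∪ augmentation a α k

end

end IntrinsicSelection

/-!
Only the last step of the algorithm matters: any selected set that contains the active set `S₀` with
probability tending to one is persistent.

The oracle predictiveness `v s = V(f_{0,s}, P₀)` is monotone in `s`, because the classes `𝓕_s` are
nested. The Shapley importance of a feature is a strictly positively weighted sum of increments
of `v`, so a feature of nonpositive importance never changes `v`
(`insert_eq_of_spvim_nonpos`). Adding the inactive features one at a time, `v s = v univ` for every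
`s ⊇ S₀` (`eq_univ_of_activeSet_subset`). Hence the best function using `|s|` variables has the
predictiveness of `f_{0,s}` (`maximizer_sizeClass_eq`), and on the event `S₀ ⊆ S_n⁺` the quantity
of interest is `V(f_{n,s}, P₀) - V(f_{0,s}, P₀)` at `s = S_n⁺`. For each fixed `s` this vanishes in
probability by the local quadratic bound and the consistency of the estimator
(`Optimality.tendstoInMeasure`); as there are finitely many `s`, so it does at the random `S_n⁺`
(`tendstoInMeasure_of_finite_selection`).
-/

namespace IntrinsicSelection

/-- A feature whose Shapley importance is not positive adds nothing to a monotone predictiveness,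
whichever features are already present. -/
lemma insert_eq_of_spvim_nonpos {p : ℕ} {v : Finset (Fin p) → ℝ} (hv : Monotone v) {j : Fin p}
    (hj : spvim v j ≤ 0) {s : Finset (Fin p)} (hjs : j ∉ s) : v (insert j s) = v s := by
  have hp : 0 < p := j.pos
  have hmono (t : Finset (Fin p)) : 0 ≤ v (insert j t) - v t :=
    sub_nonneg.2 (hv (Finset.subset_insert j t))
  have hmem : s ∈ (Finset.univ.erase j).powerset :=
    Finset.mem_powerset.2 (Finset.subset_erase.2 ⟨Finset.subset_univ s, hjs⟩)
  have hcard : s.card ≤ p - 1 := by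
    simpa using Finset.card_le_card (Finset.mem_powerset.1 hmem)
  have hw : 0 < ((Nat.choose (p - 1) s.card : ℝ))⁻¹ * (1 / (p : ℝ)) := by
    have := Nat.choose_pos hcard
    positivity
  have hle := Finset.single_le_sum
    (f := fun s : Finset (Fin p) =>
      ((Nat.choose (p - 1) s.card : ℝ))⁻¹ * (1 / (p : ℝ)) * (v (insert j s) - v s))
    (fun t _ => mul_nonneg (by positivity) (hmono t)) hmem
  have := nonpos_of_mul_nonpos_right (hle.trans hj) hw
  linarith [hmono s]

/-- A set of features containing the active set is as predictive as the set of all features. -/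
lemma eq_univ_of_activeSet_subset {p : ℕ} {v : Finset (Fin p) → ℝ} (hv : Monotone v)
    {s : Finset (Fin p)} (hs : activeSet v ⊆ s) : v s = v Finset.univ := by
  have key (t : Finset (Fin p)) (ht : Disjoint t s) : v (t ∪ s) = v s := by
    induction t using Finset.induction_on with
    | empty => simp
    | insert j t hjt ih =>
      rw [Finset.disjoint_insert_left] at ht
      have hj : spvim v j ≤ 0 := by
        by_contra! h
        exact ht.1 (hs (by simpa [activeSet] using h))
      rw [Finset.insert_union, insert_eq_of_spvim_nonpos hv hj (by simp [hjt, ht.1]), ih ht.2]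
  rw [← key sᶜ disjoint_compl_left, Finset.union_comm, Finset.union_compl]

section Oracle

variable {p : ℕ} {𝒳 : Set (Fin p → ℝ)} {E : Submodule ℝ (𝒳 → ℝ)} {F : Set E}
  {V : E → SignedMeasure (Obs 𝒳) → ℝ} {P : ProbabilityMeasure (Obs 𝒳)}
  {f₀ : Finset (Fin p) → E}

lemma restrictedClass_mono : Monotone (restrictedClass F) :=
  fun _ _ hst _ hf => ⟨hf.1, fun u v huv => hf.2 u v fun j hj => huv j (hst hj)⟩

lemma oracle_monotone
    (hf₀ : ∀ s, IsPredictivenessMaximizer V P (restrictedClass F s) (f₀ s)) :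
    Monotone fun s => V (f₀ s) (toSigned P) :=
  fun s t hst => (hf₀ t).2 _ (restrictedClass_mono hst (hf₀ s).1)

/-- If `s` contains the active set, then no other choice of `|s|` variables beats `s`: the oracle for
`s` already attains the maximum over the whole class. -/
lemma maximizer_sizeClass_eq
    (hf₀ : ∀ s, IsPredictivenessMaximizer V P (restrictedClass F s) (f₀ s))
    {s : Finset (Fin p)} (hs : activeSet (fun s => V (f₀ s) (toSigned P)) ⊆ s) {f : E}
    (hf : IsPredictivenessMaximizer V P (sizeClass F s.card) f) :
    V f (toSigned P) = V (f₀ s) (toSigned P) := by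
  refine le_antisymm ?_ (hf.2 _ ⟨s, rfl, (hf₀ s).1⟩)
  obtain ⟨t, -, ht⟩ := hf.1
  have huniv := eq_univ_of_activeSet_subset (oracle_monotone hf₀) hs
  rw [huniv]
  exact (hf₀ Finset.univ).2 f (restrictedClass_mono (Finset.subset_univ t) ht)

end Oracle

section Convergence

variable {p : ℕ} {𝒳 : Set (Fin p → ℝ)} {E : Submodule ℝ (𝒳 → ℝ)}
  {V : E → SignedMeasure (Obs 𝒳) → ℝ} {P : ProbabilityMeasure (Obs 𝒳)}
  {A : Set E} {nrm : Seminorm ℝ E} {f₀ : E} {Ω : Type*} [MeasurableSpace Ω] {μ : Measure Ω}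
  {f : ℕ → Ω → E}

/-- The sequential optimality condition makes `V(·, P)` continuous at `f₀` within `A`. -/
lemma Optimality.exists_ball (h : Optimality V P A nrm f₀) {ε : ℝ} (hε : 0 < ε) :
    ∃ η > 0, ∀ g ∈ A, nrm (g - f₀) < η → |V g (toSigned P) - V f₀ (toSigned P)| < ε := by
  obtain ⟨C, -, hC⟩ := h
  by_contra! hcon
  choose g hgA hg hgV using fun j : ℕ => hcon (1 / ((j : ℝ) + 1)) Nat.one_div_pos_of_nat
  have hlim : Tendsto (fun j => nrm (g j - f₀)) atTop (𝓝 0) :=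
    squeeze_zero (fun j => apply_nonneg nrm _) (fun j => (hg j).le)
      tendsto_one_div_add_atTop_nhds_zero_nat
  obtain ⟨J, hJ⟩ := hC g hgA hlim
  have hlim' : Tendsto (fun j => C * nrm (g j - f₀) ^ 2) atTop (𝓝 0) := by
    simpa using (hlim.pow 2).const_mul C
  obtain ⟨j, hj, hjJ⟩ := ((hlim'.eventually_lt_const hε).and (eventually_gt_atTop J)).exists
  linarith [hJ j hjJ, hgV j]

lemma QuarterRate.tendstoInMeasure (h : QuarterRate μ nrm f f₀) :
    TendstoInMeasure μ (fun n ω => nrm (f n ω - f₀)) atTop (fun _ => 0) := by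
  rw [QuarterRate, tendstoInMeasure_iff_norm] at h
  rw [tendstoInMeasure_iff_norm]
  intro ε hε
  refine tendsto_of_tendsto_of_tendsto_of_le_of_le' tendsto_const_nhds (h ε hε)
    (Eventually.of_forall fun _ => zero_le) ?_
  -- The factor `n ^ (1/4)` is at least one except at `n = 0`, where it vanishes.
  filter_upwards [eventually_ge_atTop 1] with n hn
  refine measure_mono fun ω hω => ?_
  simp only [Set.mem_ofPred_eq, sub_zero, norm_mul] at hω ⊢
  have h1 : (1 : ℝ) ≤ ‖(n : ℝ) ^ (1 / 4 : ℝ)‖ :=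
    (Real.one_le_rpow (by exact_mod_cast hn) (by norm_num)).trans (le_abs_self _)
  exact hω.trans (le_mul_of_one_le_left (norm_nonneg _) h1)

lemma Optimality.tendstoInMeasure (h : Optimality V P A nrm f₀) (hA : ∀ n ω, f n ω ∈ A)
    (hf : TendstoInMeasure μ (fun n ω => nrm (f n ω - f₀)) atTop (fun _ => 0)) :
    TendstoInMeasure μ (fun n ω => V (f n ω) (toSigned P)) atTop
      (fun _ => V f₀ (toSigned P)) := by
  rw [tendstoInMeasure_iff_norm] at hf ⊢
  intro ε hε
  obtain ⟨η, hη, hball⟩ := h.exists_ball hε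
  refine tendsto_of_tendsto_of_tendsto_of_le_of_le tendsto_const_nhds (hf η hη)
    (fun _ => zero_le) fun n => measure_mono fun ω hω => ?_
  simp only [Set.mem_ofPred_eq, sub_zero, Real.norm_eq_abs] at hω ⊢
  by_contra! hlt
  exact hω.not_gt (hball _ (hA n ω) ((le_abs_self _).trans_lt hlt))

end Convergence

/-- Finitely many sequences that tend to `0` in probability still do so along a random choice `S n`
among them, and the limit is unaffected by what happens off events `G n` of probability tending to
one. -/
lemma tendstoInMeasure_of_finite_selection {ι Ω : Type*} [Fintype ι] [MeasurableSpace Ω]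
    {μ : Measure Ω} [IsProbabilityMeasure μ] {X : ι → ℕ → Ω → ℝ} {Y : ℕ → Ω → ℝ}
    {S : ℕ → Ω → ι} {G : ℕ → Set Ω} (hX : ∀ i, TendstoInMeasure μ (X i) atTop (fun _ => 0))
    (hGm : ∀ n, MeasurableSet (G n)) (hG : Tendsto (fun n => μ (G n)) atTop (𝓝 1))
    (hY : ∀ n, ∀ ω ∈ G n, Y n ω = X (S n ω) n ω) :
    TendstoInMeasure μ Y atTop (fun _ => 0) := by
  intro ε hε
  have hGc : Tendsto (fun n => μ (G n)ᶜ) atTop (𝓝 0) := by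
    simp_rw [prob_compl_eq_one_sub (hGm _)]
    simpa using ENNReal.Tendsto.sub tendsto_const_nhds hG (Or.inl ENNReal.one_ne_top)
  have hsum := hGc.add (tendsto_finsetSum Finset.univ fun i _ => hX i ε hε)
  simp only [Finset.sum_const_zero, add_zero] at hsum
  refine tendsto_of_tendsto_of_tendsto_of_le_of_le tendsto_const_nhds hsum
    (fun _ => zero_le) fun n => ?_
  refine (measure_mono (t := (G n)ᶜ ∪ ⋃ i, {ω | ε ≤ edist (X i n ω) 0}) fun ω hω => ?_).trans
    ((measure_union_le _ _).trans (add_le_add_right (measure_iUnion_fintype_le μ _) _))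
  by_cases hωG : ω ∈ G n
  · refine Or.inr (Set.mem_iUnion.2 ⟨S n ω, ?_⟩)
    simpa only [Set.mem_ofPred_eq, hY n ω hωG] using hω
  · exact Or.inl hωG

lemma measurableSet_subset_initialSet {p : ℕ} {Ω : Type*} [MeasurableSpace Ω]
    {a : Ω → Fin p → ℝ} (ha : ∀ j, Measurable fun ω => a ω j) (s : Finset (Fin p)) (α : ℝ) :
    MeasurableSet {ω | s ⊆ initialSet (a ω) α} := by
  have : {ω | s ⊆ initialSet (a ω) α} = ⋂ j ∈ s, {ω | a ω j < α} := by
    ext ω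
    simp [Finset.subset_iff, initialSet]
  rw [this]
  exact Finset.measurableSet_biInter s fun j _ => measurableSet_lt (ha j) measurable_const

end IntrinsicSelection

open IntrinsicSelection in
theorem lemma2
    -- covariate space, class of functions with its norms, predictiveness measure, model
    {p : ℕ} (𝒳 : Set (Fin p → ℝ)) (E : Submodule ℝ (𝒳 → ℝ)) (F : Set E)
    (nrm : Finset (Fin p) → Seminorm ℝ E)
    (V : E → SignedMeasure (Obs 𝒳) → ℝ)
    (M : Set (ProbabilityMeasure (Obs 𝒳))) (P₀ : ProbabilityMeasure (Obs 𝒳)) (hP₀ : P₀ ∈ M)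
    -- oracle prediction functions
    (f₀ : Finset (Fin p) → E)
    (hf₀ : ∀ s, IsPredictivenessMaximizer V P₀ (restrictedClass F s) (f₀ s))
    -- complete data
    {Ω : Type*} [MeasurableSpace Ω] (μ : Measure Ω) [IsProbabilityMeasure μ]
    (Z : ℕ → Ω → Obs 𝒳) (hZ : IsIIDSample μ P₀ Z)
    -- estimators of the prediction functions, possibly randomized
    (learner : Ω → Finset (Fin p) → List (Obs 𝒳) → E)
    (hlearner : ∀ ω s l, learner ω s l ∈ restrictedClass F s)
    -- cross-fitted estimator of the Shapley importance from `c n` sampled feature sets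
    (K : ℕ) (hK : 2 ≤ K) (fold : ℕ → Ω → ℕ → Fin K)
    (c : ℕ → ℕ) (draw : (n : ℕ) → Fin (c n) → Ω → Finset (Fin p))
    (hdraw : IsSubsetSample μ Z c draw)
    (ψ : ℕ → Ω → Fin p → ℝ)
    (hψ : ∀ n ω, IsSpvimEstimate
      (fun s => crossFitted V (learner ω s) (fold n ω) n (fun i => Z i ω))
      (fun i => draw n i ω) (ψ n ω))
    -- standard errors, and the adjustment of the p-values by any (possibly random) procedure
    (se : ℕ → Ω → Fin p → ℝ)
    (adjust : ℕ → Ω → (Fin p → ℝ) → (Fin p → ℝ) → Fin p → ℝ)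
    (adjP : ℕ → Ω → Fin p → ℝ)
    (hadjP : ∀ n ω, adjP n ω = adjust n ω (testStatistic (ψ n ω) (se n ω))
      (pValue (testStatistic (ψ n ω) (se n ω))))
    (hadjP_meas : ∀ n j, Measurable (fun ω => adjP n ω j))
    -- level, and the (possibly data-dependent) number of augmentations
    (α : ℝ) (hα : α ∈ Set.Ioo (0 : ℝ) 1)
    (k : ℕ → Ω → ℕ) (hk : ∀ n ω, k n ω ≤ p - (initialSet (adjP n ω) α).card)
    -- a best function using as many variables as are selected
    (fstar : ℕ → Ω → E)
    (hfstar : ∀ n ω, IsPredictivenessMaximizer V P₀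
      (sizeClass F (augmentedSet (adjP n ω) α (k n ω)).card) (fstar n ω))
    -- regularity conditions
    (hA1 : ∀ s, Optimality V P₀ (restrictedClass F s) (nrm s) (f₀ s))
    (hA2 : ∀ s, UniformDifferentiability V M P₀ (restrictedClass F s) (nrm s) (f₀ s))
    (hA5 : ∀ s, QuarterRate μ (nrm s) (fullFit learner Z s) (f₀ s))
    (hA6 : ∀ s, DerivativeConsistency μ V P₀ (fullFit learner Z s) (f₀ s))
    (hA7 : SubsetCountRate c)
    -- perfect asymptotic power of the initial selection
    (hB3 : Tendsto (fun n => μ {ω | activeSet (fun s => V (f₀ s) (toSigned P₀)) ⊆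
      initialSet (adjP n ω) α}) atTop (𝓝 1)) :
    TendstoInMeasure μ
      (fun n ω => V (fullFit learner Z (augmentedSet (adjP n ω) α (k n ω)) n ω) (toSigned P₀)
        - V (fstar n ω) (toSigned P₀))
      atTop (fun _ => 0) := by
  refine tendstoInMeasure_of_finite_selection
    (X := fun s n ω => V (fullFit learner Z s n ω) (toSigned P₀) - V (f₀ s) (toSigned P₀))
    (S := fun n ω => augmentedSet (adjP n ω) α (k n ω)) (fun s => ?_)
    (fun n => measurableSet_subset_initialSet (hadjP_meas n) _ α) hB3 (fun n ω hω => ?_)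
  · have h := (hA1 s).tendstoInMeasure (f := fullFit learner Z s)
      (fun n ω => hlearner ω s _) (hA5 s).tendstoInMeasure
    rw [tendstoInMeasure_iff_norm] at h ⊢
    simpa only [sub_zero] using h
  · have hsub : activeSet (fun s => V (f₀ s) (toSigned P₀)) ⊆ augmentedSet (adjP n ω) α (k n ω) :=
      Finset.Subset.trans hω Finset.subset_union_left
    rw [maximizer_sizeClass_eq hf₀ hsub (hfstar n ω)]
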